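/- Let $p>3$ be a prime and let $n\ge 1$ be an integer. Let $\mathrm{SL}_2(\mathbb Z/p^n)$ act on $\mathbb Z/p^n[X,Y]$ by $$\begin{pmatrix}a&b\\c&d\end{pmatrix}\cdot P(X,Y)=P(aX+cY,\;bX+dY),$$ and let $\mathrm{SL}_2(\mathbb Z)$ act through the reduction map $\mathrm{SL}_2(\mathbb Z)\to \mathrm{SL}_2(\mathbb Z/p^n)$. Put $$f_{1,n}=(X^pY-XY^p)^{p^{n-1}},\qquad f_{2,n}=\left(\frac{X^{p^2-1}-Y^{p^2-1}}{X^{p-1}-Y^{p-1}}\right)^{p^{n-1}}$$ in $\mathbb Z/p^n[X,Y]$. Then: (1) $f_{1,n}$ and $f_{2,n}$ are $\mathrm{SL}_2(\mathbb Z/p^n)$-invariant and algebraically independent over $\mathbb Z/p^n$, so that $\mathbb Z/p^n[f_{1,n},f_{2,n}]$ is a polynomial ring of invariants. (2) For $G=\mathrm{SL}_2(\mathbb Z/p^n)$ and for $G=\mathrm{SL}_2(\mathbb Z)$, the ring $\mathbb Z/p^n[f_{1,n},f_{2,n}]$ is a primitive invariant submodule of $\mathbb Z/p^n[X,Y]$,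 that is, it is maximal, with respect to inclusion, among the $\mathbb Z/p^n$-submodules of $\mathbb Z/p^n[X,Y]^G$ that are free over $\mathbb Z/p^n$. (3) For either $G$, every element of $\mathbb Z/p^n[X,Y]^G$ of additive order $p^n$ is congruent modulo $p$ to an element of $\mathbb Z/p^n[f_{1,n},f_{2,n}]$. -/

import Mathlib

open MvPolynomial

noncomputable section

/-- Linear substitution in two variables: for a matrix `g` with rows `(a, b)` and `(c, d)`,
`P(X, Y)` is sent to `P(aX + cY, bX + dY)`, where `X = X 0` and `Y = X 1`. -/
def substHom {R : Type*} [CommRing R] (g : Matrix (Fin 2) (Fin 2) R) :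
    MvPolynomial (Fin 2) R →ₐ[R] MvPolynomial (Fin 2) R :=
  aeval fun j => C (g 0 j) * X 0 + C (g 1 j) * X 1

/-- The action of `SL₂(R)` on `R[X, Y]`: `g • P (X, Y) = P (aX + cY, bX + dY)`. -/
def polyRep (R : Type*) [CommRing R] :
    Representation R (Matrix.SpecialLinearGroup (Fin 2) R) (MvPolynomial (Fin 2) R) where
  toFun g := (substHom (g : Matrix (Fin 2) (Fin 2) R)).toLinearMap
  map_one' := by
    have h : substHom (1 : Matrix (Fin 2) (Fin 2) R) = AlgHom.id R _ := by
      ext j : 1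
      fin_cases j <;> simp [substHom]
    rw [Matrix.SpecialLinearGroup.coe_one, h]
    rfl
  map_mul' g h := by
    have key : substHom ((g * h : Matrix.SpecialLinearGroup (Fin 2) R) :
        Matrix (Fin 2) (Fin 2) R) = (substHom (g : Matrix (Fin 2) (Fin 2) R)).comp
          (substHom (h : Matrix (Fin 2) (Fin 2) R)) := by
      ext j : 1
      simp only [substHom, Matrix.SpecialLinearGroup.coe_mul, Matrix.mul_apply, Fin.sum_univ_two,
        aeval_X, AlgHom.comp_apply, map_add, map_mul, algHom_C, algebraMap_eq]
      ring
    rw [key]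
    rfl

/-- The action of `SL₂(ℤ)` on `R[X, Y]`, through reduction `SL₂(ℤ) → SL₂(R)`. -/
def polyRepInt (R : Type*) [CommRing R] :
    Representation R (Matrix.SpecialLinearGroup (Fin 2) ℤ) (MvPolynomial (Fin 2) R) :=
  (polyRep R).comp (Matrix.SpecialLinearGroup.map (Int.castRingHom R))

/-- A primitive invariant submodule of a representation: a submodule of the invariants that is
maximal among the submodules of the invariants that are free over the coefficient ring. -/
def IsPrimitiveInvariantSubmodule {R G M : Type*} [CommRing R] [Group G] [AddCommGroup M]
    [Module R M] (ρ : Representation R G M) (N : Submodule R M) : Prop :=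
  Maximal (fun N' : Submodule R M => N' ≤ ρ.invariants ∧ Module.Free R N') N

/-- Dickson's polynomial `X ^ p * Y - X * Y ^ p`. -/
def dicksonOne (p : ℕ) (R : Type*) [CommRing R] : MvPolynomial (Fin 2) R :=
  X 0 ^ p * X 1 - X 0 * X 1 ^ p

/-- Dickson's polynomial `(X ^ (p ^ 2 - 1) - Y ^ (p ^ 2 - 1)) / (X ^ (p - 1) - Y ^ (p - 1))`,
written as the geometric sum of `X ^ ((p - 1) * i) * Y ^ ((p - 1) * (p - i))` for `0 ≤ i ≤ p`.
That it is the quotient, and the only one, is `dicksonTwo_unique` below. -/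
def dicksonTwo (p : ℕ) (R : Type*) [CommRing R] : MvPolynomial (Fin 2) R :=
  ∑ i ∈ Finset.range (p + 1), X 0 ^ ((p - 1) * i) * X 1 ^ ((p - 1) * (p - i))

theorem dicksonTwo_mul (p : ℕ) (R : Type*) [CommRing R] :
    dicksonTwo p R * (X 0 ^ (p - 1) - X 1 ^ (p - 1)) =
      X 0 ^ (p ^ 2 - 1) - X 1 ^ (p ^ 2 - 1) := by
  have h := (Commute.all (X 0 ^ (p - 1) : MvPolynomial (Fin 2) R) (X 1 ^ (p - 1))).geom_sum₂_mul
    (p + 1)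
  have e : p ^ 2 - 1 = (p - 1) * (p + 1) := by
    rw [mul_comm]
    simpa using Nat.sq_sub_sq p 1
  rw [e, pow_mul, pow_mul, ← h, dicksonTwo]
  simp only [pow_mul, Nat.add_sub_cancel]

theorem X_pow_sub_X_pow_mem_nonZeroDivisors (R : Type*) [CommRing R] {k : ℕ} (hk : 0 < k) :
    (X 0 ^ k - X 1 ^ k : MvPolynomial (Fin 2) R) ∈ nonZeroDivisors (MvPolynomial (Fin 2) R) := by
  have hm : (Polynomial.X ^ k - Polynomial.C (X 0 ^ k) :
      Polynomial (MvPolynomial (Fin 1) R)).Monic :=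
    Polynomial.monic_X_pow_sub_C _ hk.ne'
  have hx : finSuccEquiv R 1 (X 0 ^ k - X 1 ^ k) =
      Polynomial.X ^ k - Polynomial.C (X 0 ^ k) := by
    have h1 : finSuccEquiv R 1 (X 1) = Polynomial.C (X 0) := finSuccEquiv_X_succ (j := 0)
    simp [h1, finSuccEquiv_X_zero]
  rw [mem_nonZeroDivisors_iff_right]
  intro z hz
  have h2 := congrArg (finSuccEquiv R 1) hz
  rw [map_mul, hx, map_zero] at h2
  have h3 := hm.mem_nonZeroDivisors
  rw [mem_nonZeroDivisors_iff_right] at h3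
  exact (finSuccEquiv R 1).injective (by rw [h3 _ h2, map_zero])

theorem dicksonTwo_unique {p : ℕ} (hp : 1 < p) {R : Type*} [CommRing R]
    (q : MvPolynomial (Fin 2) R) :
    q * (X 0 ^ (p - 1) - X 1 ^ (p - 1)) = X 0 ^ (p ^ 2 - 1) - X 1 ^ (p ^ 2 - 1) ↔
      q = dicksonTwo p R := by
  rw [← dicksonTwo_mul]
  exact mul_cancel_right_mem_nonZeroDivisors
    (X_pow_sub_X_pow_mem_nonZeroDivisors R (Nat.sub_pos_of_lt hp))

/-- `f_{1,n} = (X ^ p * Y - X * Y ^ p) ^ (p ^ (n - 1))` in `(ℤ/pⁿ)[X, Y]`, for `n ≥ 1`. -/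
def fOne (p n : ℕ) : MvPolynomial (Fin 2) (ZMod (p ^ n)) :=
  dicksonOne p (ZMod (p ^ n)) ^ p ^ (n - 1)

/-- `f_{2,n} = ((X ^ (p ^ 2 - 1) - Y ^ (p ^ 2 - 1)) / (X ^ (p - 1) - Y ^ (p - 1))) ^ (p ^ (n - 1))`
in `(ℤ/pⁿ)[X, Y]`, for `n ≥ 1`. -/
def fTwo (p n : ℕ) : MvPolynomial (Fin 2) (ZMod (p ^ n)) :=
  dicksonTwo p (ZMod (p ^ n)) ^ p ^ (n - 1)

/-- The subring `(ℤ/pⁿ)[f_{1,n}, f_{2,n}]` of `(ℤ/pⁿ)[X, Y]`. -/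
def dicksonSubalgebra (p n : ℕ) : Subalgebra (ZMod (p ^ n)) (MvPolynomial (Fin 2) (ZMod (p ^ n))) :=
  Algebra.adjoin (ZMod (p ^ n)) {fOne p n, fTwo p n}

end

/-! Everything rests on one congruence: modulo `p`, an invariant over `ℤ/pⁿ` is a `p^(n-1)`-th
power. Invariance under `X ↦ X + tY` says that a polynomial in `X` over `(ℤ/pⁿ)[Y]` is fixed by
Taylor shifts. Using `t = p^j` for decreasing `j` gives `p·m·F_m = 0` for each coefficient
(`mul_coeff_eq_zero_of_taylor_eq_self`), so monomials surviving modulo `p` have exponents divisible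
by `p^(n-1)`. The reduction is thus `g^(p^(n-1))` with `g` invariant over `𝔽_p`; Dickson's theorem
writes `g` in the two Dickson polynomials, and lifting coefficients gives (3).

Maximality is then a Nakayama argument (`le_of_free_of_forall_exists_dvd_sub`): in a larger free
module the error of the congruence is `p` times an element of that module, and iterating `n` times
removes it. Only elementary matrices with integer entries are needed, so both groups are treated at
once. -/

theorem substHom_mul {R : Type*} [CommRing R] (g h : Matrix (Fin 2) (Fin 2) R)
    (f : MvPolynomial (Fin 2) R) : substHom (g * h) f = substHom g (substHom h f) := by
  have key : substHom (g * h) = (substHom g).comp (substHom h) := by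
    ext j : 1
    simp only [substHom, Matrix.mul_apply, Fin.sum_univ_two, aeval_X, AlgHom.comp_apply, map_add,
      map_mul, algHom_C, algebraMap_eq]
    ring
  rw [key]
  rfl

theorem map_substHom {R S : Type*} [CommRing R] [CommRing S] (φ : R →+* S)
    (g : Matrix (Fin 2) (Fin 2) R) (f : MvPolynomial (Fin 2) R) :
    map φ (substHom g f) = substHom (g.map φ) (map φ f) := by
  have : (map φ).comp (substHom g : MvPolynomial (Fin 2) R →+* _) =
      (substHom (g.map φ) : MvPolynomial (Fin 2) S →+* MvPolynomial (Fin 2) S).comp (map φ) := by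
    ext j : 2
    · simp [substHom]
    · simp [substHom]
  exact congrArg (fun ψ => ψ f) this

/-- Invariance under the elementary matrices of size two. -/
def IsElementaryInvariant {R : Type*} [CommRing R] (f : MvPolynomial (Fin 2) R) : Prop :=
  (∀ t : R, substHom !![1, t; 0, 1] f = f) ∧ ∀ t : R, substHom !![1, 0; t, 1] f = f

namespace IsElementaryInvariant

variable {R : Type*} [CommRing R] {f : MvPolynomial (Fin 2) R}

theorem weyl (hf : IsElementaryInvariant f) (u : Rˣ) :
    substHom !![0, (u : R); -((u⁻¹ : Rˣ) : R), 0] f = f := by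
  have h : !![0, (u : R); -((u⁻¹ : Rˣ) : R), 0] =
      !![1, (u : R); 0, 1] * (!![1, 0; -((u⁻¹ : Rˣ) : R), 1] * !![1, (u : R); 0, 1]) := by
    simp
  rw [h, substHom_mul, substHom_mul, hf.1, hf.2, hf.1]

theorem diagonal (hf : IsElementaryInvariant f) (u : Rˣ) :
    substHom !![(u : R), 0; 0, ((u⁻¹ : Rˣ) : R)] f = f := by
  have h : !![(u : R), 0; 0, ((u⁻¹ : Rˣ) : R)] =
      !![0, (u : R); -((u⁻¹ : Rˣ) : R), 0] *
        !![0, ((-1 : Rˣ) : R); -(((-1 : Rˣ)⁻¹ : Rˣ) : R), 0] := by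
    simp
  rw [h, substHom_mul, hf.weyl, hf.weyl]

end IsElementaryInvariant

/-- Elementary matrices lift to `SL₂(ℤ)` because `ℤ → ℤ/m` is surjective. -/
theorem isElementaryInvariant_of_mem_invariants {m : ℕ} {f : MvPolynomial (Fin 2) (ZMod m)}
    (hf : f ∈ (polyRepInt (ZMod m)).invariants) : IsElementaryInvariant f := by
  refine ⟨fun t => ?_, fun t => ?_⟩ <;> obtain ⟨s, rfl⟩ := ZMod.intCast_surjective t
  · have e : !![1, (s : ZMod m); 0, 1] = !![1, s; 0, 1].map (Int.castRingHom (ZMod m)) := by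
      ext i j
      fin_cases i <;> fin_cases j <;> simp
    rw [e]
    exact hf ⟨!![1, s; 0, 1], by simp [Matrix.det_fin_two]⟩
  · have e : !![1, 0; (s : ZMod m), 1] = !![1, 0; s, 1].map (Int.castRingHom (ZMod m)) := by
      ext i j
      fin_cases i <;> fin_cases j <;> simp
    rw [e]
    exact hf ⟨!![1, 0; s, 1], by simp [Matrix.det_fin_two]⟩

theorem invariants_polyRep_le (R : Type*) [CommRing R] :
    (polyRep R).invariants ≤ (polyRepInt R).invariants := fun _ hf g =>
  hf (Matrix.SpecialLinearGroup.map (Int.castRingHom R) g)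

/-! ### Taylor shifts and divisibility of exponents -/

theorem finSuccEquiv_substHom_lower {R : Type*} [CommRing R] (t : R)
    (f : MvPolynomial (Fin 2) R) :
    finSuccEquiv R 1 (substHom !![1, 0; t, 1] f) =
      Polynomial.taylor (C t * X 0) (finSuccEquiv R 1 f) := by
  have h1 : finSuccEquiv R 1 (X 1) = Polynomial.C (X 0) := finSuccEquiv_X_succ (j := 0)
  have h2 : finSuccEquiv R 1 (C t) = Polynomial.C (C t) := by simp [finSuccEquiv_apply]
  have : ((finSuccEquiv R 1 : _ →ₐ[R] _).comp (substHom !![1, 0; t, 1])) =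
      ((Polynomial.taylorAlgHom (C t * X 0 : MvPolynomial (Fin 1) R)).restrictScalars R).comp
        (finSuccEquiv R 1 : _ →ₐ[R] _) := by
    ext j : 1
    fin_cases j <;> simp [substHom, h1, h2, finSuccEquiv_X_zero]
  exact congrArg (fun ψ => ψ f) this

theorem coeff_taylor_eq_sum {A : Type*} [CommRing A] (F : Polynomial A) (s : A) (n : ℕ) :
    (Polynomial.taylor s F).coeff n = F.coeff n + (F.coeff (n + 1) * (n + 1) * s +
      ∑ i ∈ Finset.range F.natDegree,
        ((n + (i + 2)).choose n : A) * F.coeff (n + (i + 2)) * s ^ (i + 2)) := by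
  rw [Polynomial.taylor_coeff,
    Polynomial.eval_eq_sum_range' (n := F.natDegree + 2)
      (lt_of_le_of_lt (Polynomial.natDegree_hasseDeriv_le F n) (by omega)),
    Finset.sum_range_succ', Finset.sum_range_succ']
  simp only [Polynomial.hasseDeriv_coeff]
  rw [add_comm, add_comm (Finset.sum _ _)]
  congr 1
  · simp
  · congr 1
    · simp [add_comm 1 n]; ring
    · refine Finset.sum_congr rfl fun i _ => ?_
      rw [add_comm (i + 1 + 1) n]

theorem linear_term_of_taylor_eq_self {A : Type*} [CommRing A] {F : Polynomial A} {s : A}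
    (h : Polynomial.taylor s F = F) (n : ℕ) :
    F.coeff (n + 1) * (n + 1) * s = -∑ i ∈ Finset.range F.natDegree,
        ((n + (i + 2)).choose n : A) * F.coeff (n + (i + 2)) * s ^ (i + 2) := by
  have h1 := coeff_taylor_eq_sum F s n
  rw [h] at h1
  linear_combination -h1

theorem isUnit_natCast_of_coprime {N u : ℕ} (h : u.Coprime N) {A : Type*} [CommRing A]
    [Algebra (ZMod N) A] : IsUnit (u : A) := by
  have := (ZMod.unitOfCoprime u h).isUnit.map (algebraMap (ZMod N) A)
  simpa using this

/-- A prime power `p ^ v` dividing `i + 2` is small: `v + j + 1 ≤ (i + 2) * j`. -/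
theorem add_succ_le_of_pow_dvd {p v i j : ℕ} (hp : 3 ≤ p) (hj : 1 ≤ j) (hv : p ^ v ∣ i + 2) :
    v + (j + 1) ≤ j * (i + 2) := by
  -- This is where `p = 2` would fail: `v = 1`, `i = 0`, `j = 1` violates the bound.
  have h3 : 2 * v + 1 ≤ 3 ^ v := by
    clear hv
    induction v with
    | zero => simp
    | succ v ih => rw [pow_succ]; omega
  have h1 : 2 * v + 1 ≤ i + 2 := calc
    2 * v + 1 ≤ 3 ^ v := h3
    _ ≤ p ^ v := Nat.pow_le_pow_left hp v
    _ ≤ i + 2 := Nat.le_of_dvd (by omega) hv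
  nlinarith

/-- Absorption, `(i+2)·C(k+i+2, k) = (k+i+2)·C(k+i+1, k)`, exposes the factor `k+i+2` of the
hypothesis at the cost of `i+2 = p^v·u`. The unit `u` is harmless, and `p^(j(i+2))` pays for both
`p^v` and `p^(j+1)`. -/
theorem mul_choose_mul_pow_eq_zero {p n : ℕ} (hp : p.Prime) (hp3 : 3 ≤ p) {A : Type*} [CommRing A]
    [Algebra (ZMod (p ^ n)) A] {c x : A} {i j k : ℕ} (hj : 1 ≤ j)
    (h : (p : A) ^ (j + 1) * (((k + (i + 2) : ℕ) : A) * c) * x = 0) :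
    ((k + (i + 2)).choose k : A) * c * ((p : A) ^ j * x) ^ (i + 2) = 0 := by
  obtain ⟨v, u, hu, hiu⟩ := Nat.exists_eq_pow_mul_and_not_dvd (n := i + 2) (by omega) p hp.ne_one
  have hunit : IsUnit (u : A) := isUnit_natCast_of_coprime (N := p ^ n)
    (Nat.Coprime.pow_right _ ((Nat.Prime.coprime_iff_not_dvd hp).2 hu).symm)
  obtain ⟨e, he⟩ := Nat.exists_eq_add_of_le (add_succ_le_of_pow_dvd hp3 hj ⟨u, hiu⟩)
  have hch : (k + (i + 2)) * (k + (i + 1)).choose k = (k + (i + 2)).choose k * (i + 2) := by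
    have := Nat.add_one_mul_choose_eq (k + (i + 1)) (i + 1)
    rw [← Nat.choose_symm_of_eq_add (show k + (i + 1) = k + (i + 1) from rfl)] at this
    rw [Nat.choose_symm_of_eq_add (show k + (i + 2) = k + (i + 2) from rfl)]
    exact this
  have hch' : ((k + (i + 2) : ℕ) : A) * ((k + (i + 1)).choose k : A) =
      ((k + (i + 2)).choose k : A) * ((p : A) ^ v * u) := by
    rw [← Nat.cast_pow, ← Nat.cast_mul (p ^ v), ← hiu, ← Nat.cast_mul, ← Nat.cast_mul, hch]
  refine (hunit.mul_right_eq_zero).1 ?_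
  rw [mul_pow, ← pow_mul, he, pow_add, pow_add]
  linear_combination ((k + (i + 1)).choose k : A) * x ^ (i + 1) * (p : A) ^ e * h -
    c * (p : A) ^ (j + 1) * (p : A) ^ e * x ^ (i + 2) * hch'

/-- Descending induction on the power of `p`, starting from `p^n = 0`: if `p^(j+1)` kills every
`m·F_m·x`, all higher terms of the shift by `p^j·x` vanish, so its linear term does too. The descent
needs `j ≥ 1`, hence the remaining factor `p`. -/
theorem mul_coeff_eq_zero_of_taylor_eq_self {p n : ℕ} (hp : p.Prime) (hp3 : 3 ≤ p) (hn : 1 ≤ n)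
    {A : Type*} [CommRing A] [Algebra (ZMod (p ^ n)) A] {F : Polynomial A} {x : A}
    (h : ∀ j, Polynomial.taylor ((p : A) ^ j * x) F = F) (m : ℕ) :
    (p : A) * ((m : A) * F.coeff m) * x = 0 := by
  have key : ∀ a, a + 1 ≤ n → ∀ m : ℕ, (p : A) ^ (n - a) * ((m : A) * F.coeff m) * x = 0 := by
    intro a
    induction a with
    | zero =>
      intro _ m
      have : (p : A) ^ n = 0 := by
        rw [← Nat.cast_pow, ← map_natCast (algebraMap (ZMod (p ^ n)) A), ZMod.natCast_self, map_zero]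
      simp [this]
    | succ a ih =>
      intro ha m
      obtain ⟨j, hj⟩ : ∃ j, n - a = j + 1 := ⟨n - a - 1, by omega⟩
      have ih' := ih (by omega)
      rw [hj] at ih'
      rw [show n - (a + 1) = j by omega]
      cases m with
      | zero => simp
      | succ m =>
        have h1 := linear_term_of_taylor_eq_self (h j) m
        rw [Finset.sum_eq_zero fun (i : ℕ) _ => mul_choose_mul_pow_eq_zero (n := n) (i := i)
          hp hp3 (by omega) (ih' (m + (i + 2)))] at h1
        push_cast
        linear_combination h1
  have := key (n - 1) (by omega) m
  rwa [show n - (n - 1) = 1 by omega, pow_one] at this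

/-- With `x = Y`, multiplication by `x` loses no coefficients, so `p·μ₀·c = 0` in `ℤ/pⁿ`, where `c`
is prime to `p`. -/
theorem pow_dvd_of_coeff_map_ne_zero {p n : ℕ} (hp : p.Prime) (hp3 : 3 ≤ p) (hn : 1 ≤ n)
    {f : MvPolynomial (Fin 2) (ZMod (p ^ n))}
    (hf : ∀ t, substHom !![1, 0; t, 1] f = f) {μ : Fin 2 →₀ ℕ}
    (hμ : coeff μ (map (ZMod.castHom (dvd_pow_self p (by omega : n ≠ 0)) (ZMod p)) f) ≠ 0) :
    p ^ (n - 1) ∣ μ 0 := by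
  set F := finSuccEquiv (ZMod (p ^ n)) 1 f with hF
  have h := mul_coeff_eq_zero_of_taylor_eq_self hp hp3 hn (F := F)
    (x := (X 0 : MvPolynomial (Fin 1) (ZMod (p ^ n)))) (fun j => by
      rw [hF]
      conv_rhs => rw [← hf ((p : ZMod (p ^ n)) ^ j)]
      rw [finSuccEquiv_substHom_lower]
      simp) (μ 0)
  have h1 := congrArg (coeff (μ.tail + Finsupp.single 0 1)) h
  rw [coeff_mul_X] at h1
  have h2 : (p : ZMod (p ^ n)) * ((μ 0 : ℕ) * coeff μ f) = 0 := by
    have e : ((p : MvPolynomial (Fin 1) (ZMod (p ^ n))) * (((μ 0 : ℕ) : MvPolynomial (Fin 1) _) *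
        F.coeff (μ 0))) = C (p * (μ 0 : ℕ) : ZMod (p ^ n)) * F.coeff (μ 0) := by
      simp [mul_assoc]
    rw [e, coeff_C_mul, finSuccEquiv_coeff_coeff, Finsupp.cons_tail, coeff_zero, mul_assoc] at h1
    exact h1
  rw [coeff_map] at hμ
  have : NeZero (p ^ n) := ⟨pow_ne_zero _ hp.ne_zero⟩
  obtain ⟨c, hc⟩ := ZMod.natCast_zmod_surjective (coeff μ f)
  rw [← hc] at hμ h2
  have hpc : ¬ p ∣ c := by
    simpa [ZMod.natCast_eq_zero_iff] using hμ
  have h3 : p ^ n ∣ p * (μ 0 * c) := by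
    rw [← ZMod.natCast_eq_zero_iff]
    push_cast
    exact h2
  obtain ⟨m, rfl⟩ := Nat.exists_eq_add_of_le hn
  rw [add_comm, pow_succ', Nat.mul_dvd_mul_iff_left hp.pos] at h3
  rw [add_tsub_cancel_left]
  exact Nat.Coprime.dvd_of_dvd_mul_right
    (Nat.Coprime.pow_left _ ((Nat.Prime.coprime_iff_not_dvd hp).2 hpc)) h3

/-! ### Restriction to the coordinate axes -/

theorem X_one_dvd_of_aeval_eq_zero {R : Type*} [CommRing R] {f : MvPolynomial (Fin 2) R}
    (h : aeval ![(Polynomial.X : Polynomial R), 0] f = 0) : X 1 ∣ f := by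
  let π := Ideal.Quotient.mkₐ R (Ideal.span {(X 1 : MvPolynomial (Fin 2) R)})
  have h1 : π (X 1) = 0 := Ideal.Quotient.eq_zero_iff_mem.2 (Ideal.mem_span_singleton_self _)
  have key : (π.comp (Polynomial.aeval (X 0))).comp
      (aeval ![(Polynomial.X : Polynomial R), 0]) = π := by
    ext j : 1
    fin_cases j <;> simp [h1]
  have h2 : π f = 0 := by rw [← key, AlgHom.comp_apply, h, map_zero]
  exact Ideal.mem_span_singleton.1 (Ideal.Quotient.eq_zero_iff_mem.1 h2)

theorem X_zero_dvd_of_aeval_eq_zero {R : Type*} [CommRing R] {f : MvPolynomial (Fin 2) R}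
    (h : aeval ![0, (Polynomial.X : Polynomial R)] f = 0) : X 0 ∣ f := by
  let π := Ideal.Quotient.mkₐ R (Ideal.span {(X 0 : MvPolynomial (Fin 2) R)})
  have h1 : π (X 0) = 0 := Ideal.Quotient.eq_zero_iff_mem.2 (Ideal.mem_span_singleton_self _)
  have key : (π.comp (Polynomial.aeval (X 1))).comp
      (aeval ![0, (Polynomial.X : Polynomial R)]) = π := by
    ext j : 1
    fin_cases j <;> simp [h1]
  have h2 : π f = 0 := by rw [← key, AlgHom.comp_apply, h, map_zero]
  exact Ideal.mem_span_singleton.1 (Ideal.Quotient.eq_zero_iff_mem.1 h2)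

theorem aeval_X_zero_eq_map_finSuccEquiv {R : Type*} [CommRing R] (f : MvPolynomial (Fin 2) R) :
    aeval ![(Polynomial.X : Polynomial R), 0] f =
      (finSuccEquiv R 1 f).map constantCoeff := by
  have h1 : finSuccEquiv R 1 (X 1) = Polynomial.C (X 0) := finSuccEquiv_X_succ (j := 0)
  have key : (aeval ![(Polynomial.X : Polynomial R), 0] : _ →ₐ[R] _).toRingHom =
      (Polynomial.mapRingHom constantCoeff).comp
        (finSuccEquiv R 1).toAlgHom.toRingHom := by
    ext j : 2
    · simp [finSuccEquiv_apply]
    · fin_cases j <;> simp [h1, finSuccEquiv_X_zero]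
  exact congrArg (fun ψ => ψ f) key

theorem coeff_aeval_X_zero {R : Type*} [CommRing R] (f : MvPolynomial (Fin 2) R) (j : ℕ) :
    (aeval ![(Polynomial.X : Polynomial R), 0] f).coeff j = coeff (Finsupp.cons j 0) f := by
  rw [aeval_X_zero_eq_map_finSuccEquiv, Polynomial.coeff_map, constantCoeff_eq,
    finSuccEquiv_coeff_coeff]

theorem linear_term_of_taylor_eq_self' {A : Type*} [CommRing A] {F : Polynomial A} {s : A}
    (h : Polynomial.taylor s F = F) (n : ℕ) :
    F.coeff (n + 1) * (n + 1) * s = (-∑ i ∈ Finset.range F.natDegree,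
        ((n + (i + 2)).choose n : A) * F.coeff (n + (i + 2)) * s ^ i) * s * s := by
  rw [linear_term_of_taylor_eq_self h n, neg_mul, neg_mul, Finset.sum_mul, Finset.sum_mul]
  exact congrArg _ (Finset.sum_congr rfl fun i _ => by ring)

/-- In the shift by `Y` the linear term is a multiple of `Y²`; comparing coefficients of `Y` kills
the constant term of `j·F_j`. -/
theorem mul_coeff_aeval_X_zero_eq_zero {R : Type*} [CommRing R] {f : MvPolynomial (Fin 2) R}
    (hf : substHom !![1, 0; 1, 1] f = f) (j : ℕ) :
    (j : R) * (aeval ![(Polynomial.X : Polynomial R), 0] f).coeff j = 0 := by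
  cases j with
  | zero => simp
  | succ j =>
    set F := finSuccEquiv R 1 f with hF
    have h : Polynomial.taylor (X 0) F = F := by
      have := finSuccEquiv_substHom_lower 1 f
      rw [hf] at this
      simpa using this.symm
    have h2 := linear_term_of_taylor_eq_self' h j
    have h3 := congrArg (coeff (0 + Finsupp.single 0 1)) h2
    rw [coeff_mul_X, coeff_mul_X, ← constantCoeff_eq] at h3
    rw [aeval_X_zero_eq_map_finSuccEquiv, Polynomial.coeff_map]
    simpa [mul_comm] using h3

theorem aeval_X_zero_substHom_diagonal {R : Type*} [CommRing R] (a b : R)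
    (f : MvPolynomial (Fin 2) R) :
    aeval ![(Polynomial.X : Polynomial R), 0] (substHom !![a, 0; 0, b] f) =
      (aeval ![(Polynomial.X : Polynomial R), 0] f).comp (Polynomial.C a * Polynomial.X) := by
  have key : (aeval ![(Polynomial.X : Polynomial R), 0]).comp (substHom !![a, 0; 0, b]) =
      (Polynomial.aeval (R := R) (Polynomial.C a * Polynomial.X)).comp
        (aeval ![(Polynomial.X : Polynomial R), 0]) := by
    ext j : 1
    fin_cases j <;> simp [substHom]
  exact congrArg (fun ψ => ψ f) key

/-! ### The Dickson polynomials and Dickson's theorem over `𝔽_p` -/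

theorem dicksonOne_eq_mul {p : ℕ} (hp : 1 ≤ p) (R : Type*) [CommRing R] :
    dicksonOne p R = X 0 * X 1 * (X 0 ^ (p - 1) - X 1 ^ (p - 1)) := by
  obtain ⟨k, rfl⟩ := Nat.exists_eq_add_of_le' hp
  simp only [dicksonOne, Nat.add_sub_cancel]
  ring

theorem dicksonTwo_mul_dicksonOne {p : ℕ} (hp : 1 ≤ p) (R : Type*) [CommRing R] :
    dicksonTwo p R * dicksonOne p R = dicksonOne (p ^ 2) R := by
  rw [dicksonOne_eq_mul (Nat.one_le_pow 2 p hp), dicksonOne_eq_mul hp, ← dicksonTwo_mul]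
  ring

theorem dicksonOne_mem_nonZeroDivisors {p : ℕ} (hp : 1 < p) (R : Type*) [CommRing R] :
    dicksonOne p R ∈ nonZeroDivisors (MvPolynomial (Fin 2) R) := by
  have hX : ∀ i : Fin 2, (X i : MvPolynomial (Fin 2) R) ∈
      nonZeroDivisors (MvPolynomial (Fin 2) R) := fun i => by
    rw [mem_nonZeroDivisors_iff_right]
    intro z hz
    ext m
    rw [← coeff_mul_X m i, hz, coeff_zero, coeff_zero]
  rw [dicksonOne_eq_mul hp.le]
  exact mul_mem (mul_mem (hX 0) (hX 1))
    (X_pow_sub_X_pow_mem_nonZeroDivisors R (Nat.sub_pos_of_lt hp))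

theorem aeval_X_zero_dicksonOne {p : ℕ} (hp : p ≠ 0) (R : Type*) [CommRing R] :
    aeval ![(Polynomial.X : Polynomial R), 0] (dicksonOne p R) = 0 := by
  simp [dicksonOne, hp]

theorem aeval_X_zero_dicksonTwo {p : ℕ} (hp : 1 < p) (R : Type*) [CommRing R] :
    aeval ![(Polynomial.X : Polynomial R), 0] (dicksonTwo p R) =
      Polynomial.X ^ (p * (p - 1)) := by
  rw [dicksonTwo, map_sum, Finset.sum_range_succ, Finset.sum_eq_zero]
  · simp [mul_comm]
  · intro i hi
    have hi' := Finset.mem_range.1 hi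
    have h : (p - 1) * (p - i) ≠ 0 := Nat.mul_ne_zero (by omega) (by omega)
    simp only [map_mul, map_pow, aeval_X, Matrix.cons_val_one, Matrix.cons_val_fin_one,
      zero_pow h, mul_zero]

theorem totalDegree_dicksonTwo_le (p : ℕ) (R : Type*) [CommRing R] [Nontrivial R] :
    (dicksonTwo p R).totalDegree ≤ p * (p - 1) := by
  refine totalDegree_finsetSum_le fun i hi => (totalDegree_mul _ _).trans ?_
  rw [totalDegree_X_pow, totalDegree_X_pow, ← mul_add,
    Nat.add_sub_cancel' (Finset.mem_range_succ_iff.1 hi), mul_comm]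

section

variable {p : ℕ} [Fact p.Prime]

/-- The polynomial is the determinant with rows `(X^q, Y^q)` and `(X, Y)`, `q = p^k`. As `q`-th
powers are `𝔽_p`-linear, substitution multiplies it by `det g`. -/
theorem substHom_dicksonOne_pow (k : ℕ) {g : Matrix (Fin 2) (Fin 2) (ZMod p)} (hg : g.det = 1) :
    substHom g (dicksonOne (p ^ k) (ZMod p)) = dicksonOne (p ^ k) (ZMod p) := by
  have h : ∀ a b : ZMod p, (C a * X 0 + C b * X 1 : MvPolynomial (Fin 2) (ZMod p)) ^ p ^ k =
      C a * X 0 ^ p ^ k + C b * X 1 ^ p ^ k := fun a b => by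
    rw [add_pow_char_pow, mul_pow, mul_pow, ← C_pow, ← C_pow, ZMod.pow_card_pow, ZMod.pow_card_pow]
  have hd : (C (g 0 0) * C (g 1 1) - C (g 0 1) * C (g 1 0) : MvPolynomial (Fin 2) (ZMod p)) = 1 := by
    rw [← C_mul, ← C_mul, ← C_sub, ← Matrix.det_fin_two, hg, C_1]
  simp only [dicksonOne, substHom, map_sub, map_mul, map_pow, aeval_X, h]
  linear_combination (X 0 ^ p ^ k * X 1 - X 0 * X 1 ^ p ^ k) * hd

theorem substHom_dicksonOne {g : Matrix (Fin 2) (Fin 2) (ZMod p)} (hg : g.det = 1) :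
    substHom g (dicksonOne p (ZMod p)) = dicksonOne p (ZMod p) := by
  simpa using substHom_dicksonOne_pow 1 hg

theorem substHom_dicksonTwo {g : Matrix (Fin 2) (Fin 2) (ZMod p)} (hg : g.det = 1) :
    substHom g (dicksonTwo p (ZMod p)) = dicksonTwo p (ZMod p) := by
  have hp : 1 < p := (Fact.out : p.Prime).one_lt
  rw [← mul_cancel_right_mem_nonZeroDivisors (dicksonOne_mem_nonZeroDivisors hp (ZMod p)),
    dicksonTwo_mul_dicksonOne hp.le]
  conv_lhs => rw [← substHom_dicksonOne hg]
  rw [← map_mul, dicksonTwo_mul_dicksonOne hp.le, substHom_dicksonOne_pow 2 hg]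

theorem substHom_eq_of_mem_adjoin {g : Matrix (Fin 2) (Fin 2) (ZMod p)} (hg : g.det = 1)
    {f : MvPolynomial (Fin 2) (ZMod p)}
    (hf : f ∈ Algebra.adjoin (ZMod p) {dicksonOne p (ZMod p), dicksonTwo p (ZMod p)}) :
    substHom g f = f := by
  have : Algebra.adjoin (ZMod p) {dicksonOne p (ZMod p), dicksonTwo p (ZMod p)} ≤
      AlgHom.equalizer (substHom g) (AlgHom.id (ZMod p) _) := by
    rw [Algebra.adjoin_le_iff]
    rintro _ (rfl | rfl)
    · exact substHom_dicksonOne hg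
    · exact substHom_dicksonTwo hg
  exact this hf

/-- The group moves the line `Y = 0` to every line `X + cY = 0`, so each of these forms divides `f`,
and `dicksonOne` is the product of all of them with `Y`. -/
theorem dicksonOne_dvd {f : MvPolynomial (Fin 2) (ZMod p)} (hf : IsElementaryInvariant f)
    (h : X 1 ∣ f) : dicksonOne p (ZMod p) ∣ f := by
  have hp : 1 < p := (Fact.out : p.Prime).one_lt
  have h1 : finSuccEquiv (ZMod p) 1 (X 1) = Polynomial.C (X 0) := finSuccEquiv_X_succ (j := 0)
  have h2 : ∀ c, finSuccEquiv (ZMod p) 1 (C c) = Polynomial.C (C c) := fun c => by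
    simp [finSuccEquiv_apply]
  obtain ⟨q, rfl⟩ := h
  set D : Polynomial (MvPolynomial (Fin 1) (ZMod p)) :=
    Polynomial.X ^ p - Polynomial.C (X 0 ^ (p - 1)) * Polynomial.X with hD
  have hdeg : (Polynomial.C (X 0 ^ (p - 1)) * Polynomial.X :
      Polynomial (MvPolynomial (Fin 1) (ZMod p))).degree < p :=
    (Polynomial.degree_C_mul_X_le _).trans_lt (by exact_mod_cast hp)
  have hmonic : D.Monic := Polynomial.monic_X_pow_sub hdeg
  have hnat : D.natDegree = p := Polynomial.natDegree_eq_of_degree_eq_some (by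
      rw [hD, Polynomial.degree_sub_eq_left_of_degree_lt] <;> rw [Polynomial.degree_X_pow]
      exact hdeg)
  have heval : ∀ c : ZMod p, (finSuccEquiv (ZMod p) 1 q).eval (-(C c * X 0)) = 0 := by
    intro c
    have hc : X 0 + C c * X 1 ∣ X 1 * q := by
      have hm : !![0, 1; -1, c] = !![0, ((1 : (ZMod p)ˣ) : ZMod p);
          -(((1 : (ZMod p)ˣ)⁻¹ : (ZMod p)ˣ) : ZMod p), 0] * !![1, -c; 0, 1] := by
        simp
      have hs : substHom !![0, 1; -1, c] (X 1 * q) = X 1 * q := by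
        rw [hm, substHom_mul, hf.1, hf.weyl]
      rw [← hs, map_mul]
      refine Dvd.dvd.mul_right (dvd_of_eq ?_) _
      simp [substHom]
    obtain ⟨e, he⟩ := hc
    have h3 := congrArg (fun u => (finSuccEquiv (ZMod p) 1 u).eval (-(C c * X 0))) he
    simp only [map_mul, map_add, h1, h2, finSuccEquiv_X_zero, Polynomial.eval_mul,
      Polynomial.eval_add, Polynomial.eval_X, Polynomial.eval_C, neg_add_cancel, zero_mul] at h3
    exact (mul_eq_zero.1 h3).resolve_left (X_ne_zero 0)
  -- The remainder has degree below `p` in `X` but the `p` distinct roots `-cY`.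
  have hmod : finSuccEquiv (ZMod p) 1 q %ₘ D = 0 := by
    refine Polynomial.eq_zero_of_natDegree_lt_card_of_eval_eq_zero _
      (f := fun c : ZMod p => -(C c * X 0 : MvPolynomial (Fin 1) (ZMod p))) ?_ ?_ ?_
    · intro a b hab
      exact C_injective _ _ (mul_right_cancel₀ (X_ne_zero 0) (neg_injective hab))
    · intro c
      rw [Polynomial.modByMonic_eq_sub_mul_div _ D, Polynomial.eval_sub, Polynomial.eval_mul, heval]
      have : D.eval (-(C c * X 0)) = 0 := by
        have e : (-(C c * X 0) : MvPolynomial (Fin 1) (ZMod p)) ^ p = -(C c * X 0 ^ p) := by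
          rw [← neg_mul, ← C_neg, mul_pow, ← C_pow, ZMod.pow_card, C_neg, neg_mul]
        simp only [hD, Polynomial.eval_sub, Polynomial.eval_pow, Polynomial.eval_X,
          Polynomial.eval_mul, Polynomial.eval_C, e]
        linear_combination C c * pow_sub_one_mul hp.ne_bot (X 0 : MvPolynomial (Fin 1) (ZMod p))
      rw [this, zero_mul, sub_zero]
    · rw [ZMod.card]
      conv_rhs => rw [← hnat]
      exact Polynomial.natDegree_modByMonic_lt _ hmonic (by
        intro h1; rw [h1, Polynomial.natDegree_one] at hnat; omega)
  rw [Polynomial.modByMonic_eq_zero_iff_dvd hmonic] at hmod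
  have hD' : D = finSuccEquiv (ZMod p) 1 (X 0 ^ p - X 1 ^ (p - 1) * X 0) := by
    simp [hD, h1, finSuccEquiv_X_zero]
  rw [hD', map_dvd_iff] at hmod
  have : dicksonOne p (ZMod p) = X 1 * (X 0 ^ p - X 1 ^ (p - 1) * X 0) := by
    obtain ⟨k, hk⟩ := Nat.exists_eq_add_of_le' hp.le
    simp only [dicksonOne, hk, Nat.add_sub_cancel]
    ring
  rw [this]
  exact mul_dvd_mul_left _ hmod

/-- Unipotent invariance gives `p ∣ j`; the diagonal torus gives `u^j = 1` for all units `u`, hence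
`p - 1 ∣ j`. -/
theorem IsElementaryInvariant.dvd_of_coeff_ne_zero {f : MvPolynomial (Fin 2) (ZMod p)}
    (hf : IsElementaryInvariant f) {j : ℕ}
    (hj : (aeval ![(Polynomial.X : Polynomial (ZMod p)), 0] f).coeff j ≠ 0) :
    p * (p - 1) ∣ j := by
  refine Nat.Coprime.mul_dvd_of_dvd_of_dvd ?_ ?_ ?_
  · exact (Nat.coprime_self_sub_right (Fact.out : p.Prime).one_le).2 (Nat.coprime_one_right p)
  · have := mul_coeff_aeval_X_zero_eq_zero (hf.2 1) j
    rwa [mul_eq_zero_iff_right hj, ZMod.natCast_eq_zero_iff] at this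
  · have := FiniteField.forall_pow_eq_one_iff (ZMod p) j
    rw [ZMod.card] at this
    rw [← this]
    intro u
    have h1 := congrArg (Polynomial.coeff · j)
      (aeval_X_zero_substHom_diagonal (u : ZMod p) ((u⁻¹ : (ZMod p)ˣ) : ZMod p) f)
    simp only [hf.diagonal, Polynomial.comp_C_mul_X_coeff] at h1
    ext
    push_cast
    exact mul_left_cancel₀ hj (by rw [← h1, mul_one])

theorem IsElementaryInvariant.sub {R : Type*} [CommRing R] {f g : MvPolynomial (Fin 2) R}
    (hf : IsElementaryInvariant f) (hg : IsElementaryInvariant g) :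
    IsElementaryInvariant (f - g) :=
  ⟨fun t => by rw [map_sub, hf.1, hg.1], fun t => by rw [map_sub, hf.2, hg.2]⟩

theorem isElementaryInvariant_of_mem_adjoin {f : MvPolynomial (Fin 2) (ZMod p)}
    (hf : f ∈ Algebra.adjoin (ZMod p) {dicksonOne p (ZMod p), dicksonTwo p (ZMod p)}) :
    IsElementaryInvariant f :=
  ⟨fun t => substHom_eq_of_mem_adjoin (by simp [Matrix.det_fin_two]) hf,
    fun t => substHom_eq_of_mem_adjoin (by simp [Matrix.det_fin_two]) hf⟩

theorem IsElementaryInvariant.of_dicksonOne_mul {f : MvPolynomial (Fin 2) (ZMod p)}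
    (hf : IsElementaryInvariant (dicksonOne p (ZMod p) * f)) : IsElementaryInvariant f := by
  have hreg := dicksonOne_mem_nonZeroDivisors (Fact.out : p.Prime).one_lt (ZMod p)
  have key : ∀ g : Matrix (Fin 2) (Fin 2) (ZMod p), g.det = 1 →
      substHom g (dicksonOne p (ZMod p) * f) = dicksonOne p (ZMod p) * f → substHom g f = f := by
    intro g hg h
    rwa [map_mul, substHom_dicksonOne hg, mul_cancel_left_mem_nonZeroDivisors hreg] at h
  exact ⟨fun t => key _ (by simp [Matrix.det_fin_two]) (hf.1 t),
    fun t => key _ (by simp [Matrix.det_fin_two]) (hf.2 t)⟩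

/-- Dickson's theorem for `SL₂(𝔽_p)`. -/
theorem IsElementaryInvariant.mem_adjoin {f : MvPolynomial (Fin 2) (ZMod p)}
    (hf : IsElementaryInvariant f) :
    f ∈ Algebra.adjoin (ZMod p) {dicksonOne p (ZMod p), dicksonTwo p (ZMod p)} := by
  have hp : 1 < p := (Fact.out : p.Prime).one_lt
  induction hN : f.totalDegree using Nat.strong_induction_on generalizing f with
  | _ N ih =>
  subst hN
  set S := Algebra.adjoin (ZMod p) {dicksonOne p (ZMod p), dicksonTwo p (ZMod p)} with hS
  have h1S : dicksonOne p (ZMod p) ∈ S := Algebra.subset_adjoin (by simp)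
  have h2S : dicksonTwo p (ZMod p) ∈ S := Algebra.subset_adjoin (by simp)
  let φ := aeval (R := ZMod p) ![(Polynomial.X : Polynomial (ZMod p)), 0]
  -- `g` matches `f` on the axis `Y = 0`, where `dicksonTwo` becomes `X^(p(p-1))`; the division is
  -- exact wherever the coefficient is nonzero.
  let g : MvPolynomial (Fin 2) (ZMod p) := ∑ j ∈ Finset.range (f.totalDegree + 1),
    C ((φ f).coeff j) * dicksonTwo p (ZMod p) ^ (j / (p * (p - 1)))
  have hgS : g ∈ S := sum_mem fun j _ => mul_mem (S.algebraMap_mem _) (pow_mem h2S _)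
  have hgdeg : g.totalDegree ≤ f.totalDegree := by
    refine totalDegree_finsetSum_le fun j hj => (totalDegree_mul _ _).trans ?_
    rw [totalDegree_C, zero_add]
    calc _ ≤ j / (p * (p - 1)) * (dicksonTwo p (ZMod p)).totalDegree := totalDegree_pow _ _
      _ ≤ j / (p * (p - 1)) * (p * (p - 1)) :=
        Nat.mul_le_mul_left _ (totalDegree_dicksonTwo_le p (ZMod p))
      _ ≤ j := Nat.div_mul_le_self _ _
      _ ≤ _ := Finset.mem_range_succ_iff.1 hj
  have hφdeg : (φ f).natDegree < f.totalDegree + 1 := by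
    refine Nat.lt_succ_of_le ((Polynomial.natDegree_le_iff_coeff_eq_zero).2 fun j hj => ?_)
    rw [coeff_aeval_X_zero]
    by_contra h
    have := le_totalDegree (mem_support_iff.2 h)
    rw [Finsupp.sum_fintype _ _ (fun _ => rfl), Fin.sum_univ_two] at this
    simp at this
    omega
  have hφ : φ (f - g) = 0 := by
    rw [map_sub, sub_eq_zero]
    conv_lhs => rw [Polynomial.as_sum_range' _ _ hφdeg]
    rw [map_sum]
    refine Finset.sum_congr rfl fun j _ => ?_
    by_cases hj : (φ f).coeff j = 0
    · simp [hj]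
    · have h2 : φ (dicksonTwo p (ZMod p)) = Polynomial.X ^ (p * (p - 1)) :=
        aeval_X_zero_dicksonTwo hp (ZMod p)
      rw [map_mul, map_pow, h2, ← pow_mul, Nat.mul_div_cancel' (hf.dvd_of_coeff_ne_zero hj),
        algHom_C, Polynomial.algebraMap_eq, Polynomial.C_mul_X_pow_eq_monomial]
  have hinv := hf.sub (isElementaryInvariant_of_mem_adjoin hgS)
  obtain ⟨q, hq⟩ := dicksonOne_dvd hinv (X_one_dvd_of_aeval_eq_zero hφ)
  have hqS : q ∈ S := by
    by_cases hq0 : q = 0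
    · rw [hq0]; exact zero_mem S
    rw [hq] at hinv
    refine ih _ ?_ hinv.of_dicksonOne_mul rfl
    -- A factor `Y` is enough to make `dicksonOne` of positive degree, so `q` has smaller degree
    -- than `f`.
    have hd : X 1 ∣ dicksonOne p (ZMod p) :=
      X_one_dvd_of_aeval_eq_zero (aeval_X_zero_dicksonOne (by omega) _)
    obtain ⟨e, he⟩ := hd
    have hd0 : dicksonOne p (ZMod p) ≠ 0 :=
      nonZeroDivisors.ne_zero (dicksonOne_mem_nonZeroDivisors hp (ZMod p))
    have he0 : e ≠ 0 := by rintro rfl; exact hd0 (by rw [he, mul_zero])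
    have h3 := congrArg totalDegree hq
    rw [totalDegree_mul_of_isDomain hd0 hq0, he,
      totalDegree_mul_of_isDomain (X_ne_zero 1) he0, totalDegree_X] at h3
    have h4 := totalDegree_sub f g
    rw [max_eq_left hgdeg] at h4
    omega
  rw [← sub_add_cancel f g, hq]
  exact add_mem (mul_mem h1S hqS) hgS

end

/-! ### Algebraic independence, expansion and symmetry -/

/-- Setting `Y = 0` in a relation `P(a, b) = 0` leaves `P(0, X^m) = 0`, so the first variable
divides `P`. Since `a` is regular it can be cancelled, and repetition kills every coefficient. -/
theorem algebraicIndependent_pair {R : Type*} [CommRing R] {a b : MvPolynomial (Fin 2) R}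
    (ha : a ∈ nonZeroDivisors (MvPolynomial (Fin 2) R))
    (ha' : aeval ![(Polynomial.X : Polynomial R), 0] a = 0) {m : ℕ} (hm : 0 < m)
    (hb : aeval ![(Polynomial.X : Polynomial R), 0] b = Polynomial.X ^ m) :
    AlgebraicIndependent R ![a, b] := by
  have hdvd : ∀ P : MvPolynomial (Fin 2) R, aeval ![a, b] P = 0 → X 0 ∣ P := by
    intro P hP
    have key : (aeval ![(Polynomial.X : Polynomial R), 0]).comp (aeval ![a, b]) =
        (Polynomial.expand R m).comp (aeval ![0, (Polynomial.X : Polynomial R)]) := by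
      ext j : 1
      fin_cases j <;> simp [ha', hb]
    have h1 := congrArg (fun ψ => ψ P) key
    simp only [AlgHom.comp_apply, hP, map_zero] at h1
    exact X_zero_dvd_of_aeval_eq_zero ((Polynomial.expand_eq_zero hm).1 h1.symm)
  rw [algebraicIndependent_iff]
  have key : ∀ (k : ℕ) (P : MvPolynomial (Fin 2) R), aeval ![a, b] P = 0 → ∀ μ : Fin 2 →₀ ℕ, μ 0 = k → coeff μ P = 0 := by
    intro k
    induction k with
    | zero =>
      intro P hP μ hμ
      obtain ⟨Q, rfl⟩ := hdvd P hP
      rw [coeff_X_mul', if_neg (by simp [hμ])]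
    | succ k ih =>
      intro P hP μ hμ
      obtain ⟨Q, rfl⟩ := hdvd P hP
      rw [coeff_X_mul', if_pos (by simp [hμ])]
      refine ih Q ?_ _ (by simp [hμ])
      rw [map_mul, aeval_X, mul_comm] at hP
      exact (mem_nonZeroDivisors_iff_right.1 ha) _ hP
  intro P hP
  ext μ
  rw [key _ P hP μ rfl, coeff_zero]

theorem map_dicksonOne {R S : Type*} [CommRing R] [CommRing S] (φ : R →+* S) (p : ℕ) :
    map φ (dicksonOne p R) = dicksonOne p S := by
  simp [dicksonOne]

theorem map_dicksonTwo {R S : Type*} [CommRing R] [CommRing S] (φ : R →+* S) (p : ℕ) :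
    map φ (dicksonTwo p R) = dicksonTwo p S := by
  simp [dicksonTwo]

theorem rename_swap_substHom_upper {R : Type*} [CommRing R] (t : R)
    (f : MvPolynomial (Fin 2) R) :
    rename (Equiv.swap 0 1) (substHom !![1, t; 0, 1] f) =
      substHom !![1, 0; t, 1] (rename (Equiv.swap 0 1) f) := by
  have : (rename (Equiv.swap 0 1)).comp (substHom !![1, t; 0, 1]) =
      (substHom !![1, 0; t, 1]).comp (rename (Equiv.swap (0 : Fin 2) 1)) := by
    ext j : 1
    fin_cases j <;> simp [substHom, add_comm]
  exact congrArg (fun ψ => ψ f) this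

theorem expand_pow_zmod {σ : Type*} {p : ℕ} [Fact p.Prime] (k : ℕ)
    (g : MvPolynomial σ (ZMod p)) : expand (p ^ k) g = g ^ p ^ k := by
  induction k with
  | zero => simp
  | succ k ih => rw [pow_succ', expand_mul, ih, expand_zmod, ← pow_mul, mul_comm]

theorem exists_expand_eq {σ R : Type*} [CommRing R] {q : ℕ} {f : MvPolynomial σ R}
    (h : ∀ μ, coeff μ f ≠ 0 → ∀ i, q ∣ μ i) : ∃ g, expand q g = f := by
  refine ⟨∑ μ ∈ f.support, monomial (μ.mapRange (· / q) (Nat.zero_div q)) (coeff μ f), ?_⟩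
  rw [map_sum]
  conv_rhs => rw [f.as_sum]
  refine Finset.sum_congr rfl fun μ hμ => ?_
  have : q • μ.mapRange (· / q) (Nat.zero_div q) = μ := by
    ext i
    simpa using Nat.mul_div_cancel' (h μ (mem_support_iff.1 hμ) i)
  rw [expand_monomial, this]

/-! ### Passage between `𝔽_p` and `ℤ/pⁿ` -/

section

variable {p n : ℕ}

/-- Reduction modulo `p` on `ℤ/pⁿ`. -/
def reduction (p : ℕ) {n : ℕ} (hn : n ≠ 0) : ZMod (p ^ n) →+* ZMod p :=
  ZMod.castHom (dvd_pow_self p hn) (ZMod p)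

theorem reduction_surjective (hn : n ≠ 0) : Function.Surjective (reduction p hn) :=
  ZMod.castHom_surjective _

theorem map_reduction_eq_zero_iff [Fact p.Prime] (hn : n ≠ 0)
    (f : MvPolynomial (Fin 2) (ZMod (p ^ n))) :
    map (reduction p hn) f = 0 ↔ (p : MvPolynomial (Fin 2) (ZMod (p ^ n))) ∣ f := by
  have hp : p.Prime := Fact.out
  rw [← C_dvd_iff_map_hom_eq_zero (reduction p hn) (p : ZMod (p ^ n)), map_natCast C]
  intro r
  have : NeZero (p ^ n) := ⟨pow_ne_zero _ hp.ne_zero⟩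
  obtain ⟨c, rfl⟩ := ZMod.natCast_zmod_surjective r
  rw [map_natCast, ZMod.natCast_eq_zero_iff]
  refine ⟨fun h => Nat.cast_dvd_cast h, fun h => ?_⟩
  rw [← ZMod.natCast_eq_zero_iff, ← map_natCast (reduction p hn)]
  obtain ⟨d, hd⟩ := h
  rw [hd, map_mul, map_natCast, ZMod.natCast_self, zero_mul]

/-- Elements congruent modulo `p` have `p^(n-1)`-th powers congruent modulo `p^n`. -/
theorem substHom_pow_eq [Fact p.Prime] (hn : n ≠ 0) {g : Matrix (Fin 2) (Fin 2) (ZMod (p ^ n))}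
    {d : MvPolynomial (Fin 2) (ZMod (p ^ n))}
    (h : substHom (g.map (reduction p hn)) (map (reduction p hn) d) = map (reduction p hn) d) :
    substHom g (d ^ p ^ (n - 1)) = d ^ p ^ (n - 1) := by
  have h1 : (p : MvPolynomial (Fin 2) (ZMod (p ^ n))) ∣ substHom g d - d := by
    rw [← map_reduction_eq_zero_iff hn, map_sub, map_substHom, h, sub_self]
  have h2 := dvd_sub_pow_of_dvd_sub h1 (n - 1)
  rw [Nat.sub_add_cancel (Nat.one_le_iff_ne_zero.2 hn), ← Nat.cast_pow,
    CharP.cast_eq_zero, zero_dvd_iff, sub_eq_zero] at h2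
  rwa [map_pow]

theorem det_map_reduction (hn : n ≠ 0) (g : Matrix.SpecialLinearGroup (Fin 2) (ZMod (p ^ n))) :
    ((g : Matrix (Fin 2) (Fin 2) (ZMod (p ^ n))).map (reduction p hn)).det = 1 :=
  (Matrix.SpecialLinearGroup.map (reduction p hn) g).det_coe

theorem fOne_mem_invariants [Fact p.Prime] (hn : n ≠ 0) :
    fOne p n ∈ (polyRep (ZMod (p ^ n))).invariants := fun g =>
  substHom_pow_eq hn (by rw [map_dicksonOne, substHom_dicksonOne (det_map_reduction hn g)])

theorem fTwo_mem_invariants [Fact p.Prime] (hn : n ≠ 0) :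
    fTwo p n ∈ (polyRep (ZMod (p ^ n))).invariants := fun g =>
  substHom_pow_eq hn (by rw [map_dicksonTwo, substHom_dicksonTwo (det_map_reduction hn g)])

theorem algebraicIndependent_fOne_fTwo (hp : 1 < p) (n : ℕ) :
    AlgebraicIndependent (ZMod (p ^ n)) ![fOne p n, fTwo p n] := by
  refine algebraicIndependent_pair (m := p * (p - 1) * p ^ (n - 1))
    (pow_mem (dicksonOne_mem_nonZeroDivisors hp _) _) ?_ ?_ ?_
  · rw [fOne, map_pow, aeval_X_zero_dicksonOne (by omega), zero_pow (by positivity)]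
  · have : 0 < p - 1 := by omega
    positivity
  · rw [fTwo, map_pow, aeval_X_zero_dicksonTwo hp, ← pow_mul]

theorem dicksonSubalgebra_le_invariants [Fact p.Prime] (hn : n ≠ 0) :
    Subalgebra.toSubmodule (dicksonSubalgebra p n) ≤ (polyRep (ZMod (p ^ n))).invariants := by
  intro f hf g
  have : dicksonSubalgebra p n ≤ AlgHom.equalizer
      (substHom (g : Matrix (Fin 2) (Fin 2) (ZMod (p ^ n)))) (AlgHom.id (ZMod (p ^ n)) _) := by
    rw [dicksonSubalgebra, Algebra.adjoin_le_iff]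
    rintro _ (rfl | rfl)
    · exact fOne_mem_invariants hn g
    · exact fTwo_mem_invariants hn g
  exact this hf

theorem dicksonSubalgebra_eq_adjoin_range (p n : ℕ) :
    dicksonSubalgebra p n = Algebra.adjoin _ (Set.range ![fOne p n, fTwo p n]) := by
  rw [dicksonSubalgebra, Matrix.range_cons, Matrix.range_cons, Matrix.range_empty, Set.union_empty,
    Set.singleton_union]

theorem free_dicksonSubalgebra (hp : 1 < p) (n : ℕ) :
    Module.Free (ZMod (p ^ n)) (Subalgebra.toSubmodule (dicksonSubalgebra p n)) := by
  rw [dicksonSubalgebra_eq_adjoin_range]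
  exact Module.Free.of_equiv (algebraicIndependent_fOne_fTwo hp n).aevalEquiv.toLinearEquiv

theorem IsElementaryInvariant.map_reduction (hn : n ≠ 0) {f : MvPolynomial (Fin 2) (ZMod (p ^ n))}
    (hf : IsElementaryInvariant f) : IsElementaryInvariant (map (reduction p hn) f) := by
  refine ⟨fun t => ?_, fun t => ?_⟩ <;> obtain ⟨s, rfl⟩ := reduction_surjective hn t
  · conv_rhs => rw [← hf.1 s, map_substHom]
    congr 2
    ext i j
    fin_cases i <;> fin_cases j <;> simp
  · conv_rhs => rw [← hf.2 s, map_substHom]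
    congr 2
    ext i j
    fin_cases i <;> fin_cases j <;> simp

theorem IsElementaryInvariant.of_pow [Fact p.Prime] {k : ℕ} {g : MvPolynomial (Fin 2) (ZMod p)}
    (hg : IsElementaryInvariant (g ^ p ^ k)) : IsElementaryInvariant g := by
  have hinj := iterateFrobenius_inj (MvPolynomial (Fin 2) (ZMod p)) p k
  refine ⟨fun t => hinj ?_, fun t => hinj ?_⟩
  · simpa only [iterateFrobenius_def, map_pow] using hg.1 t
  · simpa only [iterateFrobenius_def, map_pow] using hg.2 t

theorem IsElementaryInvariant.exists_pow_eq_map_reduction [Fact p.Prime] (hp3 : 3 ≤ p) (hn : n ≠ 0)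
    {f : MvPolynomial (Fin 2) (ZMod (p ^ n))} (hf : IsElementaryInvariant f) :
    ∃ g, g ^ p ^ (n - 1) = map (reduction p hn) f := by
  have hp : p.Prime := Fact.out
  have hn1 := Nat.one_le_iff_ne_zero.2 hn
  obtain ⟨g, hg⟩ := exists_expand_eq (q := p ^ (n - 1)) (f := map (reduction p hn) f) (by
    intro μ hμ i
    fin_cases i
    · exact pow_dvd_of_coeff_map_ne_zero hp hp3 hn1 hf.2 hμ
    -- Swapping the variables exchanges upper and lower unipotents, reducing to the exponent of `X`.
    · have hinj : Function.Injective (Equiv.swap (0 : Fin 2) 1) := Equiv.injective _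
      have h1 := pow_dvd_of_coeff_map_ne_zero hp hp3 hn1 (f := rename (Equiv.swap 0 1) f)
        (μ := μ.mapDomain (Equiv.swap (0 : Fin 2) 1))
        (fun t => by rw [← rename_swap_substHom_upper, hf.1])
        (by rwa [map_rename, coeff_rename_mapDomain _ hinj])
      have h2 := Finsupp.mapDomain_apply hinj μ 1
      rw [Equiv.swap_apply_right] at h2
      rwa [h2] at h1)
  exact ⟨g, by rw [← hg, expand_pow_zmod]⟩

theorem IsElementaryInvariant.exists_mem_dicksonSubalgebra [Fact p.Prime] (hp3 : 3 ≤ p)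
    (hn : n ≠ 0) {f : MvPolynomial (Fin 2) (ZMod (p ^ n))} (hf : IsElementaryInvariant f) :
    ∃ h ∈ dicksonSubalgebra p n, (p : MvPolynomial (Fin 2) (ZMod (p ^ n))) ∣ f - h := by
  obtain ⟨g, hg⟩ := hf.exists_pow_eq_map_reduction hp3 hn
  have hg' : IsElementaryInvariant g := .of_pow (k := n - 1) (hg ▸ hf.map_reduction hn)
  have hmem := hg'.mem_adjoin
  have hr : ({dicksonOne p (ZMod p), dicksonTwo p (ZMod p)} : Set _) =
      Set.range ![dicksonOne p (ZMod p), dicksonTwo p (ZMod p)] := by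
    rw [Matrix.range_cons, Matrix.range_cons, Matrix.range_empty, Set.union_empty,
      Set.singleton_union]
  rw [hr, Algebra.adjoin_range_eq_range_aeval] at hmem
  obtain ⟨P, rfl⟩ := hmem
  obtain ⟨Q, rfl⟩ := map_surjective _ (reduction_surjective hn) P
  refine ⟨aeval ![fOne p n, fTwo p n] Q, ?_, ?_⟩
  · rw [dicksonSubalgebra_eq_adjoin_range, Algebra.adjoin_range_eq_range_aeval]
    exact ⟨Q, rfl⟩
  · rw [← map_reduction_eq_zero_iff hn, map_sub, ← hg, sub_eq_zero]
    -- Frobenius fixes coefficients in `𝔽_p`, so the power passes to the two arguments.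
    have h1 : (aeval ![dicksonOne p (ZMod p), dicksonTwo p (ZMod p)] (map (reduction p hn) Q)) ^
        p ^ (n - 1) = aeval (![dicksonOne p (ZMod p), dicksonTwo p (ZMod p)] ^ p ^ (n - 1))
          (map (reduction p hn) Q) := by
      rw [← aeval_expand, expand_pow_zmod, map_pow]
    refine h1.trans ?_
    have key : (aeval (R := ZMod p) (![dicksonOne p (ZMod p), dicksonTwo p (ZMod p)] ^
          p ^ (n - 1))).toRingHom.comp (map (reduction p hn)) =
        (map (reduction p hn)).comp
          (aeval (R := ZMod (p ^ n)) ![fOne p n, fTwo p n]).toRingHom := by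
      ext j : 2
      · simp
      · fin_cases j <;> simp [fOne, fTwo, map_dicksonOne, map_dicksonTwo]
    exact congrArg (fun ψ => ψ Q) key

/-! ### Freeness and maximality -/

/-- In `ℤ/pⁿ` the annihilator of `p^(n-1)` is `(p)`; apply this to each coordinate in a basis. -/
theorem exists_eq_smul_of_pow_smul_eq_zero [Fact p.Prime] (hn : n ≠ 0) {M : Type*} [AddCommGroup M]
    [Module (ZMod (p ^ n)) M] [Module.Free (ZMod (p ^ n)) M] {y : M}
    (hy : (p : ZMod (p ^ n)) ^ (n - 1) • y = 0) : ∃ z : M, (p : ZMod (p ^ n)) • z = y := by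
  have hp : p.Prime := Fact.out
  let b := Module.Free.chooseBasis (ZMod (p ^ n)) M
  have hr : ∀ r : ZMod (p ^ n), (p : ZMod (p ^ n)) ^ (n - 1) * r = 0 → ∃ c, r = p * c := by
    intro r hr
    have : NeZero (p ^ n) := ⟨pow_ne_zero _ hp.ne_zero⟩
    obtain ⟨c, rfl⟩ := ZMod.natCast_zmod_surjective r
    obtain ⟨m, rfl⟩ := Nat.exists_eq_succ_of_ne_zero hn
    rw [← Nat.cast_pow, ← Nat.cast_mul, ZMod.natCast_eq_zero_iff, Nat.succ_eq_add_one,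
      Nat.add_sub_cancel, pow_succ, Nat.mul_dvd_mul_iff_left (pow_pos hp.pos m)] at hr
    obtain ⟨d, rfl⟩ := hr
    exact ⟨d, by push_cast; rfl⟩
  change y ∈ LinearMap.range (LinearMap.lsmul (ZMod (p ^ n)) M (p : ZMod (p ^ n)))
  rw [← b.linearCombination_repr y, Finsupp.linearCombination_apply]
  refine Submodule.sum_mem _ fun i _ => ?_
  obtain ⟨c, hc⟩ := hr (b.repr y i) (by
    rw [← smul_eq_mul, ← Finsupp.smul_apply, ← map_smul, hy, map_zero, Finsupp.zero_apply])
  exact ⟨c • b i, by rw [LinearMap.lsmul_apply, smul_smul, ← hc]⟩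

/-- The difference `f - h` is divisible by `p` only in the polynomial ring, but it is killed by
`p^(n-1)`, and freeness of `N'` makes it divisible by `p` inside `N'`. Hence `N' = N + pN'`, and `p`
is nilpotent. -/
theorem le_of_free_of_forall_exists_dvd_sub [Fact p.Prime] (hn : n ≠ 0)
    {N N' : Submodule (ZMod (p ^ n)) (MvPolynomial (Fin 2) (ZMod (p ^ n)))} (hle : N ≤ N')
    [Module.Free (ZMod (p ^ n)) N']
    (h : ∀ f ∈ N', ∃ h ∈ N, (p : MvPolynomial (Fin 2) (ZMod (p ^ n))) ∣ f - h) : N' ≤ N := by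
  have hpn : (p : ZMod (p ^ n)) ^ n = 0 := by rw [← Nat.cast_pow, ZMod.natCast_self]
  have h1 : ∀ f ∈ N', ∃ h ∈ N, ∃ z ∈ N', f = h + (p : ZMod (p ^ n)) • z := by
    intro f hf
    obtain ⟨h, hh, e, he⟩ := h f hf
    obtain ⟨z, hz⟩ := exists_eq_smul_of_pow_smul_eq_zero hn
      (p := p) (y := (⟨f - h, sub_mem hf (hle hh)⟩ : N')) (by
        ext1
        change (p : ZMod (p ^ n)) ^ (n - 1) • (f - h) = 0
        rw [he, ← map_natCast (C : ZMod (p ^ n) →+* MvPolynomial (Fin 2) (ZMod (p ^ n))),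
          ← smul_eq_C_mul, smul_smul, pow_sub_one_mul hn, hpn, zero_smul])
    refine ⟨h, hh, z, z.2, ?_⟩
    have := congrArg Subtype.val hz
    change (p : ZMod (p ^ n)) • (z : MvPolynomial (Fin 2) (ZMod (p ^ n))) = f - h at this
    rw [this, add_sub_cancel]
  have h2 : ∀ k, ∀ f ∈ N', ∃ h ∈ N, ∃ z ∈ N', f = h + (p : ZMod (p ^ n)) ^ k • z := by
    intro k
    induction k with
    | zero => exact fun f hf => ⟨0, zero_mem N, f, hf, by simp⟩
    | succ k ih =>
      intro f hf
      obtain ⟨h, hh, z, hz, rfl⟩ := ih f hf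
      obtain ⟨h', hh', z', hz', rfl⟩ := h1 z hz
      exact ⟨h + (p : ZMod (p ^ n)) ^ k • h', add_mem hh (N.smul_mem _ hh'), z', hz', by
        rw [smul_add, smul_smul, ← pow_succ, add_assoc]⟩
  intro f hf
  obtain ⟨h, hh, z, _, rfl⟩ := h2 n f hf
  rwa [hpn, zero_smul, add_zero]

/-- Bounding the invariants of `ρ` between those of the two groups covers both cases at once. -/
theorem isPrimitiveInvariantSubmodule_dicksonSubalgebra [Fact p.Prime] (hp3 : 3 ≤ p) (hn : n ≠ 0)
    {G : Type*} [Group G]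
    {ρ : Representation (ZMod (p ^ n)) G (MvPolynomial (Fin 2) (ZMod (p ^ n)))}
    (hle : (polyRep (ZMod (p ^ n))).invariants ≤ ρ.invariants)
    (hρ : ρ.invariants ≤ (polyRepInt (ZMod (p ^ n))).invariants) :
    IsPrimitiveInvariantSubmodule ρ (Subalgebra.toSubmodule (dicksonSubalgebra p n)) := by
  refine ⟨⟨(dicksonSubalgebra_le_invariants hn).trans hle, free_dicksonSubalgebra (by omega) n⟩,
    fun N' ⟨hN', hfree⟩ hNN' => le_of_free_of_forall_exists_dvd_sub hn hNN' fun f hf => ?_⟩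
  exact (isElementaryInvariant_of_mem_invariants
    (hρ (hN' hf))).exists_mem_dicksonSubalgebra hp3 hn

end

theorem mainTheorem1 (p : ℕ) (hp : p.Prime) (hp3 : 3 < p) (n : ℕ) (hn : 1 ≤ n) :
    -- the two elements are invariant under `SL₂(ℤ/pⁿ)` and algebraically independent
    fOne p n ∈ (polyRep (ZMod (p ^ n))).invariants ∧
    fTwo p n ∈ (polyRep (ZMod (p ^ n))).invariants ∧
    AlgebraicIndependent (ZMod (p ^ n)) ![fOne p n, fTwo p n] ∧
    -- they generate a primitive invariant submodule, both for `SL₂(ℤ/pⁿ)` and for `SL₂(ℤ)`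
    IsPrimitiveInvariantSubmodule (polyRep (ZMod (p ^ n)))
      (Subalgebra.toSubmodule (dicksonSubalgebra p n)) ∧
    IsPrimitiveInvariantSubmodule (polyRepInt (ZMod (p ^ n)))
      (Subalgebra.toSubmodule (dicksonSubalgebra p n)) ∧
    -- invariants of order `pⁿ` are congruent modulo `p` to elements of the subring
    (∀ f ∈ (polyRep (ZMod (p ^ n))).invariants, addOrderOf f = p ^ n →
      ∃ h ∈ dicksonSubalgebra p n,
        f - h ∈ Ideal.span {(p : MvPolynomial (Fin 2) (ZMod (p ^ n)))}) ∧
    (∀ f ∈ (polyRepInt (ZMod (p ^ n))).invariants, addOrderOf f = p ^ n →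
      ∃ h ∈ dicksonSubalgebra p n,
        f - h ∈ Ideal.span {(p : MvPolynomial (Fin 2) (ZMod (p ^ n)))}) := by

  have : Fact p.Prime := ⟨hp⟩
  have hn0 : n ≠ 0 := by omega
  have hle := invariants_polyRep_le (ZMod (p ^ n))
  have hmod : ∀ f ∈ (polyRepInt (ZMod (p ^ n))).invariants, ∃ h ∈ dicksonSubalgebra p n,
      f - h ∈ Ideal.span {(p : MvPolynomial (Fin 2) (ZMod (p ^ n)))} := by
    intro f hf
    simpa only [Ideal.mem_span_singleton] using
      (isElementaryInvariant_of_mem_invariants hf).exists_mem_dicksonSubalgebra hp3.le hn0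
  exact ⟨fOne_mem_invariants hn0, fTwo_mem_invariants hn0,
    algebraicIndependent_fOne_fTwo hp.one_lt n,
    isPrimitiveInvariantSubmodule_dicksonSubalgebra hp3.le hn0 le_rfl hle,
    isPrimitiveInvariantSubmodule_dicksonSubalgebra hp3.le hn0 hle le_rfl,
    fun f hf _ => hmod f (hle hf), fun f hf _ => hmod f hf⟩
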